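/- Let $n\ge 0$ and let $G$ be a simple graph with vertex set $[n]=\{1,\dots,n\}$, not necessarily connected, that is right-filled: whenever $\{i,k\}$ is an edge and $i<j<k$, then $\{j,k\}$ is also an edge. A tube of $G$ is a nonempty set $I\subseteq[n]$ such that the induced subgraph $G|_I$ is connected. Two tubes $I,J$ are compatible if $I\subseteq J$, or $J\subseteq I$, or $I\cup J$ is not a tube. A maximal tubing is an inclusion-maximal set of pairwise compatible tubes. For a tube $I$ in a maximal tubing $\mathcal X$, let $\mathrm{top}_{\mathcal X}(I)$ be the unique element of $I$ that lies in no tube of $\mathcal X$ properly contained in $I$. If $\mathcal X$ and $\mathcal Y=(\mathcal X\setminus\{I\})\cup\{J\}$ are maximal tubings with $I\in\mathcal X$ and $J\neq I$, write $\mathcal X\to\mathcal Y$ (a flip) when $\mathrm{top}_{\mathcal X}(I)<\mathrm{top}_{\mathcal Y}(J)$. Let $L_G$ be the set of maximal tubings of $G$ ordered by the reflexive transitive closure of the flip relation. A maximal tubing $T$ is identified with its $G$-forest, the forest poset on $[n]$ in which $j\le_T i$ if and only if $j$ lies in the smallest tube of $T$ containing $i$. Its inversion set is $\operatorname{inv}(T)=\{(i,j):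 i<j \text{ and } j<_T i\}$. For a permutation $w=w_1\cdots w_n\in\mathfrak S_n$, let $\operatorname{inv}(w)$ be the set of pairs $(i,k)$ with $i<k$ such that $k$ precedes $i$ in $w$. The weak order on $\mathfrak S_n$ is defined by $w\le w'$ if and only if $\operatorname{inv}(w)\subseteq\operatorname{inv}(w')$; it is a lattice. A permutation $w$ is a $G$-permutation if, for every $i\in[n]$, the elements $w_i$ and $\max\{w_1,\dots,w_i\}$ lie in the same connected component of $G|_{\{w_1,\dots,w_i\}}$. Let $\Psi_G:\mathfrak S_n\to L_G$ be the map $\Psi_G(w)=\{X_1,\dots,X_n\}$, where $X_j$ is the vertex set of the connected component of $G|_{\{w_1,\dots,w_j\}}$ that contains $w_j$. Then: 1. For all $T,T'\in L_G$, $T\le T'$ in $L_G$ if and only if $\operatorname{inv}(T)\subseteq\operatorname{inv}(T')$. 2. The poset $L_G$ is isomorphic to the subposet of the weak order on $\mathfrak S_n$ induced by the set of $G$-permutations. In particular, $L_G$ is a lattice. 3. $\Psi_G:\mathfrak S_n\to L_G$ is a meet-semilattice map: $\Psi_G(w\wedge w')=\Psi_G(w)\wedge\Psi_G(w')$ for all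 $w,w'\in\mathfrak S_n$. -/

import Mathlib

/-! Throughout, the vertex set `[n]` is `Fin n` with its usual linear order. -/

namespace SimpleGraph

variable {n : ℕ}

/-- Whenever `{i, k}` is an edge and `i < j < k`, also `{j, k}` is an edge. -/
def RightFilled (G : SimpleGraph (Fin n)) : Prop :=
  ∀ i j k : Fin n, i < j → j < k → G.Adj i k → G.Adj j k

/-- A tube is a nonempty set of vertices that induces a connected subgraph
(`Connected` includes nonemptiness). -/
def IsTube (G : SimpleGraph (Fin n)) (I : Set (Fin n)) : Prop :=
  (G.induce I).Connected

/-- Two tubes are compatible if they are nested or separated. -/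
def Compatible (G : SimpleGraph (Fin n)) (I J : Set (Fin n)) : Prop :=
  I ⊆ J ∨ J ⊆ I ∨ ¬ G.IsTube (I ∪ J)

/-- A tubing is a collection of pairwise compatible tubes. -/
def IsTubing (G : SimpleGraph (Fin n)) (X : Set (Set (Fin n))) : Prop :=
  (∀ I ∈ X, G.IsTube I) ∧ ∀ I ∈ X, ∀ J ∈ X, G.Compatible I J

/-- A maximal tubing: a tubing that is maximal by inclusion. -/
@[ext]
structure MaximalTubing (G : SimpleGraph (Fin n)) where
  tubes : Set (Set (Fin n))
  isTubing : G.IsTubing tubes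
  maximal : ∀ Y : Set (Set (Fin n)), G.IsTubing Y → tubes ⊆ Y → Y = tubes

/-- The vertex set of the connected component of `G|_S` containing `a`, i.e. the largest tube
contained in `S` and containing `a` (for `a ∈ S`): the union of all these tubes. -/
def comp (G : SimpleGraph (Fin n)) (S : Set (Fin n)) (a : Fin n) : Set (Fin n) :=
  ⋃₀ {I | G.IsTube I ∧ I ⊆ S ∧ a ∈ I}

/-! ### Basic facts on tubes -/

section facts

variable {G : SimpleGraph (Fin n)} {I J S X : Set (Fin n)} {a b u v : Fin n}

theorem isTube_singleton (a : Fin n) : G.IsTube {a} := by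
  have : Subsingleton ({a} : Set (Fin n)) := by infer_instance
  have : Nonempty ({a} : Set (Fin n)) := ⟨⟨a, rfl⟩⟩
  exact { preconnected := Preconnected.of_subsingleton }

theorem IsTube.nonempty (h : G.IsTube I) : I.Nonempty := by
  obtain ⟨x⟩ := Connected.nonempty h
  exact ⟨x.1, x.2⟩

theorem IsTube.union (hI : G.IsTube I) (hJ : G.IsTube J) (ha : a ∈ I) (hb : a ∈ J) :
    G.IsTube (I ∪ J) :=
  induce_union_connected (Connected.preconnected hI) (Connected.preconnected hJ) ⟨a, ha, hb⟩

theorem IsTube.union_adj (hI : G.IsTube I) (hJ : G.IsTube J) (hu : u ∈ I) (hv : v ∈ J)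
    (h : G.Adj u v) : G.IsTube (I ∪ J) :=
  connected_induce_union (Connected.preconnected hI) (Connected.preconnected hJ) hu hv h

/-- A connected set that meets `S` but is not contained in it has an edge leaving `S`. -/
theorem IsTube.exists_adj (hI : G.IsTube I) (ha : a ∈ I) (haS : a ∈ S) (hIS : ¬ I ⊆ S) :
    ∃ u ∈ I, u ∈ S ∧ ∃ v ∈ I, v ∉ S ∧ G.Adj u v := by
  obtain ⟨b, hb, hbS⟩ := Set.not_subset.1 hIS
  obtain ⟨p⟩ := (Connected.preconnected hI) ⟨a, ha⟩ ⟨b, hb⟩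
  obtain ⟨d, -, h1, h2⟩ := p.exists_boundary_dart (Subtype.val ⁻¹' S) haS hbS
  exact ⟨d.fst.1, d.fst.2, h1, d.snd.1, d.snd.2, h2, d.adj⟩

theorem mem_comp (ha : a ∈ S) : a ∈ G.comp S a :=
  ⟨{a}, ⟨isTube_singleton a, by simpa using ha, rfl⟩, rfl⟩

theorem comp_subset : G.comp S a ⊆ S :=
  Set.sUnion_subset fun _ hI => hI.2.1

theorem subset_comp (hI : G.IsTube I) (hIS : I ⊆ S) (ha : a ∈ I) : I ⊆ G.comp S a :=
  Set.subset_sUnion_of_mem (show I ∈ {I | G.IsTube I ∧ I ⊆ S ∧ a ∈ I} from ⟨hI, hIS, ha⟩)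

theorem isTube_comp (ha : a ∈ S) : G.IsTube (G.comp S a) :=
  induce_sUnion_connected_of_pairwise_not_disjoint
    ⟨{a}, isTube_singleton a, by simpa using ha, rfl⟩
    (fun hs ht => ⟨a, hs.2.2, ht.2.2⟩) (fun hs => hs.1)

/-- If tubes `f i ∋ i` are pairwise compatible, and `i ∈ f j`, `j ∈ f i` only for `i = j`,
then every tube that is compatible with all of them is one of them. -/
theorem mem_range_of_compatible {f : Fin n → Set (Fin n)} (hf : ∀ i, G.IsTube (f i))
    (hmem : ∀ i, i ∈ f i) (hc : ∀ i j, G.Compatible (f i) (f j))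
    (hanti : ∀ i j, i ∈ f j → j ∈ f i → i = j) {K : Set (Fin n)} (hK : G.IsTube K)
    (hKc : ∀ i, G.Compatible K (f i)) : ∃ i, f i = K := by
  obtain ⟨t, htK, htmax⟩ := Set.Finite.exists_maximalFor f K (Set.toFinite K) hK.nonempty
  have hsub : K ⊆ f t := by
    by_contra hns
    obtain ⟨u, huK, hut, v, hvK, hvt, huv⟩ := hK.exists_adj htK (hmem t) hns
    rcases hc t v with h | h | h
    · exact hvt (htmax hvK h (hmem v))
    · exact hvt (h (hmem v))
    · exact h ((hf t).union_adj (hf v) hut (hmem v) huv)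
  refine ⟨t, Set.Subset.antisymm ?_ hsub⟩
  by_contra hns
  obtain ⟨u, hut, huK, v, hvt, hvK, huv⟩ := (hf t).exists_adj (hmem t) htK hns
  rcases hKc v with h | h | h
  · exact hvK (hanti t v (h htK) hvt ▸ htK)
  · exact hvK (h (hmem v))
  · exact h (hK.union_adj (hf v) huK (hmem v) huv)

theorem Compatible.symm (h : G.Compatible I J) : G.Compatible J I := by
  rcases h with h | h | h
  · exact Or.inr (Or.inl h)
  · exact Or.inl h
  · exact Or.inr (Or.inr (by rwa [Set.union_comm]))

theorem Compatible.nested (h : G.Compatible I J) (hI : G.IsTube I) (hJ : G.IsTube J)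
    (ha : a ∈ I) (hb : a ∈ J) : I ⊆ J ∨ J ⊆ I := by
  rcases h with h | h | h
  · exact Or.inl h
  · exact Or.inr h
  · exact absurd (hI.union hJ ha hb) h

end facts

/-- The maximal tubing formed by a family of tubes as in `mem_range_of_compatible`. -/
def MaximalTubing.ofFamily {G : SimpleGraph (Fin n)} (f : Fin n → Set (Fin n))
    (hf : ∀ i, G.IsTube (f i)) (hmem : ∀ i, i ∈ f i) (hc : ∀ i j, G.Compatible (f i) (f j))
    (hanti : ∀ i j, i ∈ f j → j ∈ f i → i = j) : G.MaximalTubing where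
  tubes := Set.range f
  isTubing := by
    refine ⟨?_, ?_⟩
    · rintro _ ⟨i, rfl⟩
      exact hf i
    · rintro _ ⟨i, rfl⟩ _ ⟨j, rfl⟩
      exact hc i j
  maximal := by
    intro Y hY hsub
    refine Set.Subset.antisymm (fun K hK => ?_) hsub
    exact mem_range_of_compatible hf hmem hc hanti (hY.1 K hK)
      (fun i => hY.2 K hK _ (hsub ⟨i, rfl⟩))

/-! ### The poset of maximal tubings -/

namespace MaximalTubing

variable {G : SimpleGraph (Fin n)}

/-- `a` is the top element of the tube `I` of `X`: the element of `I` that lies in no tube of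
`X` properly contained in `I`. -/
def IsTop (X : G.MaximalTubing) (I : Set (Fin n)) (a : Fin n) : Prop :=
  a ∈ I ∧ ∀ J ∈ X.tubes, J ⊂ I → a ∉ J

/-- The flip relation `X → Y`: a tube `I` of `X` is exchanged for a different tube `J`, and the
top of `I` in `X` is smaller than the top of `J` in `Y`. -/
def Flip (X Y : G.MaximalTubing) : Prop :=
  ∃ I ∈ X.tubes, ∃ J ∈ Y.tubes, I ≠ J ∧ Y.tubes = (X.tubes \ {I}) ∪ {J} ∧
    ∃ a b : Fin n, X.IsTop I a ∧ Y.IsTop J b ∧ a < b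

/-- The order of `L_G`: `X ≤ Y` if there is a sequence of flips from `X` to `Y`. -/
instance : Preorder G.MaximalTubing where
  le := Relation.ReflTransGen Flip
  le_refl _ := Relation.ReflTransGen.refl
  le_trans _ _ _ := Relation.ReflTransGen.trans

end MaximalTubing

/-! ### `G`-forests -/

/-- A `G`-forest: a forest poset on `[n]` (the elements above any element form a chain, roots
being maximal) whose principal order ideals are tubes, such that the union of the principal
order ideals of two incomparable elements is not a tube. -/
@[ext]
structure GForest (G : SimpleGraph (Fin n)) where
  le : Fin n → Fin n → Prop
  refl : ∀ i, le i i
  trans : ∀ i j k, le i j → le j k → le i k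
  antisymm : ∀ i j, le i j → le j i → i = j
  forest : ∀ i j k, le i j → le i k → le j k ∨ le k j
  isTube : ∀ i, G.IsTube {j | le j i}
  separated : ∀ i k, ¬ le i k → ¬ le k i → ¬ G.IsTube ({j | le j i} ∪ {j | le j k})

/-- The inversion set of a `G`-forest `T`: all `(i, j)` with `i < j` as integers and
`j <_T i`. -/
def GForest.inv {G : SimpleGraph (Fin n)} (T : G.GForest) : Set (Fin n × Fin n) :=
  {p | p.1 < p.2 ∧ T.le p.2 p.1}

/-- The map `χ`: the principal order ideals of a `G`-forest form a maximal tubing. -/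
def GForest.tubing {G : SimpleGraph (Fin n)} (T : G.GForest) : G.MaximalTubing :=
  MaximalTubing.ofFamily (fun i => {j | T.le j i}) T.isTube T.refl
    (fun i k => by
      by_cases h1 : T.le i k
      · exact Or.inl fun j hj => T.trans _ _ _ hj h1
      by_cases h2 : T.le k i
      · exact Or.inr (Or.inl fun j hj => T.trans _ _ _ hj h2)
      exact Or.inr (Or.inr (T.separated i k h1 h2)))
    (fun i j hij hji => T.antisymm i j hij hji)

namespace MaximalTubing

variable {G : SimpleGraph (Fin n)} (X : G.MaximalTubing)

theorem mem_tubes {K : Set (Fin n)} (hK : G.IsTube K) (h : ∀ I ∈ X.tubes, G.Compatible K I) :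
    K ∈ X.tubes := by
  have hY : G.IsTubing (insert K X.tubes) := by
    refine ⟨?_, ?_⟩
    · rintro I (rfl | hI)
      · exact hK
      · exact X.isTubing.1 I hI
    · rintro I (rfl | hI) J (rfl | hJ)
      · exact Or.inl subset_rfl
      · exact h J hJ
      · exact (h I hI).symm
      · exact X.isTubing.2 I hI J hJ
  rw [← X.maximal _ hY (Set.subset_insert _ _)]
  exact Set.mem_insert _ _

/-- `i_↓`, the smallest tube of `X` that contains `i`. -/
def down (i : Fin n) : Set (Fin n) := ⋂₀ {I | I ∈ X.tubes ∧ i ∈ I}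

theorem mem_down (i : Fin n) : i ∈ X.down i := fun _ hI => hI.2

theorem down_subset {I : Set (Fin n)} {i : Fin n} (hI : I ∈ X.tubes) (hi : i ∈ I) :
    X.down i ⊆ I :=
  Set.sInter_subset_of_mem (show I ∈ {I | I ∈ X.tubes ∧ i ∈ I} from ⟨hI, hi⟩)

theorem down_mem (i : Fin n) : X.down i ∈ X.tubes := by
  have hne : {I | I ∈ X.tubes ∧ i ∈ I}.Nonempty := by
    have hi : i ∈ (Set.univ : Set (Fin n)) := trivial
    refine ⟨G.comp Set.univ i, X.mem_tubes (isTube_comp hi) ?_, mem_comp hi⟩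
    intro I hI
    by_cases h : G.IsTube (G.comp Set.univ i ∪ I)
    · exact Or.inr (Or.inl (Set.subset_union_right.trans
        (subset_comp h (Set.subset_univ _) (Or.inl (mem_comp hi)))))
    · exact Or.inr (Or.inr h)
  obtain ⟨M, hM⟩ := Set.Finite.exists_minimal
    (Set.toFinite {I | I ∈ X.tubes ∧ i ∈ I}) hne
  have : X.down i = M := by
    refine Set.Subset.antisymm (X.down_subset hM.prop.1 hM.prop.2) ?_
    refine Set.subset_sInter fun I hI => ?_
    rcases (X.isTubing.2 M hM.prop.1 I hI.1).nested (X.isTubing.1 _ hM.prop.1)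
      (X.isTubing.1 _ hI.1) hM.prop.2 hI.2 with h | h
    · exact h
    · exact hM.le_of_le hI h
  rw [this]
  exact hM.prop.1

theorem down_antisymm (i j : Fin n) (hij : i ∈ X.down j) (hji : j ∈ X.down i) : i = j := by
  by_contra hne
  have hj : j ∈ X.down i \ {i} := ⟨hji, fun h => hne h.symm⟩
  have hC : G.comp (X.down i \ {i}) j ∈ X.tubes := by
    refine X.mem_tubes (isTube_comp hj) fun M hM => ?_
    rcases X.isTubing.2 M hM _ (X.down_mem i) with h | h | h
    · by_cases hi : i ∈ M
      · exact Or.inl (comp_subset.trans (Set.sdiff_subset.trans (X.down_subset hM hi)))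
      · by_cases ht : G.IsTube (G.comp (X.down i \ {i}) j ∪ M)
        · refine Or.inr (Or.inl (Set.subset_union_right.trans
            (subset_comp ht (Set.union_subset comp_subset fun x hx => ⟨h hx, ?_⟩)
              (Or.inl (mem_comp hj)))))
          rintro rfl
          exact hi hx
        · exact Or.inr (Or.inr ht)
    · exact Or.inl (comp_subset.trans (Set.sdiff_subset.trans h))
    · refine Or.inr (Or.inr fun ht => h ?_)
      have := ht.union (X.isTubing.1 _ (X.down_mem i)) (Or.inl (mem_comp hj)) hji
      rwa [Set.union_right_comm, Set.union_eq_right.2 (comp_subset.trans Set.sdiff_subset),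
        Set.union_comm] at this
  exact (comp_subset (X.down_subset hC (mem_comp hj) hij)).2 rfl

/-- The map `τ`: the `G`-forest of a maximal tubing, `j ≤_T i` meaning that `j` lies in the
smallest tube `i_↓` containing `i`. -/
def forest : G.GForest where
  le j i := j ∈ X.down i
  refl := X.mem_down
  trans i j k hij hjk := X.down_subset (X.down_mem k) hjk hij
  antisymm := X.down_antisymm
  forest i j k hij hik := by
    rcases (X.isTubing.2 _ (X.down_mem j) _ (X.down_mem k)).nested
      (X.isTubing.1 _ (X.down_mem j)) (X.isTubing.1 _ (X.down_mem k)) hij hik with h | h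
    · exact Or.inl (h (X.mem_down j))
    · exact Or.inr (h (X.mem_down k))
  isTube i := X.isTubing.1 _ (X.down_mem i)
  separated i k hik hki := by
    rcases X.isTubing.2 _ (X.down_mem i) _ (X.down_mem k) with h | h | h
    · exact absurd (h (X.mem_down i)) hik
    · exact absurd (h (X.mem_down k)) hki
    · exact h

/-- The maps `χ` and `τ` are mutually inverse bijections. -/
def equivGForest : G.MaximalTubing ≃ G.GForest where
  toFun X := X.forest
  invFun T := T.tubing
  left_inv X := by
    ext1
    refine (X.forest.tubing.maximal _ X.isTubing ?_).symm
    rintro _ ⟨i, rfl⟩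
    exact X.down_mem i
  right_inv T := by
    ext j i
    refine ⟨fun h => h {j | T.le j i} ⟨⟨i, rfl⟩, T.refl i⟩, ?_⟩
    rintro h _ ⟨⟨k, rfl⟩, hk⟩
    exact T.trans _ _ _ h hk

end MaximalTubing

end SimpleGraph

/-! ### The weak order -/

/-- The symmetric group on `[n]`, to carry the weak order. The one-line notation of `w` is
`w 0, w 1, …`. -/
def WeakPerm (n : ℕ) : Type := Equiv.Perm (Fin n)

namespace WeakPerm

variable {n : ℕ}

/-- The entry in position `j`. -/
def entry (w : WeakPerm n) (j : Fin n) : Fin n := Equiv.toFun w j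

/-- The position of the entry `a`. -/
def pos (w : WeakPerm n) (a : Fin n) : Fin n := Equiv.invFun w a

theorem entry_pos (w : WeakPerm n) (a : Fin n) : w.entry (w.pos a) = a := Equiv.right_inv w a

theorem pos_entry (w : WeakPerm n) (j : Fin n) : w.pos (w.entry j) = j := Equiv.left_inv w j

theorem pos_injective (w : WeakPerm n) : Function.Injective w.pos := fun a b h => by
  rw [← w.entry_pos a, h, w.entry_pos]

/-- The inversion set: all `(i, k)` with `i < k` such that `k` precedes `i` in `w`. -/
def inv (w : WeakPerm n) : Set (Fin n × Fin n) :=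
  {p | p.1 < p.2 ∧ w.pos p.2 < w.pos p.1}

theorem pos_lt_of_inv_eq {w w' : WeakPerm n} (h : w.inv = w'.inv) {a b : Fin n}
    (hab : w.pos a < w.pos b) : w'.pos a < w'.pos b := by
  rcases lt_trichotomy a b with hlt | rfl | hlt
  · have hn : (a, b) ∉ w'.inv := by
      rw [← h]
      exact fun hm => lt_asymm hab hm.2
    refine lt_of_le_of_ne (not_lt.1 fun hl => hn ⟨hlt, hl⟩) fun he => ?_
    exact hlt.ne (w'.pos_injective he)
  · exact absurd hab (lt_irrefl _)
  · have hm : (b, a) ∈ w.inv := ⟨hlt, hab⟩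
    rw [h] at hm
    exact hm.2

theorem inv_injective : Function.Injective (inv : WeakPerm n → Set (Fin n × Fin n)) := by
  intro w w' h
  have h1 : StrictMono fun j => w'.pos (w.entry j) := fun i j hij =>
    pos_lt_of_inv_eq h (by rwa [w.pos_entry, w.pos_entry])
  have h2 : ∀ j, w'.pos (w.entry j) = j := by
    have h3 : (fun j => w'.pos (w.entry j)) = id := by
      refine StrictMono.range_inj h1 strictMono_id |>.1 ?_
      rw [Set.range_id, Set.range_eq_univ]
      intro j
      exact ⟨w.pos (w'.entry j), by simp only [w.entry_pos, w'.pos_entry]⟩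
    exact fun j => congrFun h3 j
  refine Equiv.ext fun j => ?_
  change w.entry j = w'.entry j
  rw [← w'.entry_pos (w.entry j), h2 j]

/-- The weak order: containment of inversion sets. -/
instance : PartialOrder (WeakPerm n) := PartialOrder.lift inv inv_injective

/-- The set `{w_1, …, w_j}` of the entries up to and including position `j`. -/
def initial (w : WeakPerm n) (j : Fin n) : Set (Fin n) := {a | w.pos a ≤ j}

/-- `G`-permutations: for each position `j`, the entry `w_j` and the maximum of
`{w_1, …, w_j}` lie in the same connected component of `G|_{{w_1, …, w_j}}`. -/
def IsGPermutation (G : SimpleGraph (Fin n)) (w : WeakPerm n) : Prop :=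
  ∀ j m : Fin n, IsGreatest (w.initial j) m → m ∈ G.comp (w.initial j) (w.entry j)

end WeakPerm

namespace SimpleGraph

variable {n : ℕ}

/-- The map `Ψ_G`, sending `w` to the maximal tubing `{X_1, …, X_n}`, where `X_j` is the
connected component of `G|_{{w_1, …, w_j}}` containing `w_j`. The family is indexed here by
`a = w_j` instead of by the position `j` of `a`. -/
def psi (G : SimpleGraph (Fin n)) (w : WeakPerm n) : G.MaximalTubing :=
  have key : ∀ a, a ∈ w.initial (w.pos a) := fun a => le_refl (w.pos a)
  have nest : ∀ a b, w.pos a ≤ w.pos b →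
      G.Compatible (G.comp (w.initial (w.pos a)) a) (G.comp (w.initial (w.pos b)) b) := by
    intro a b h
    by_cases ht : G.IsTube
        (G.comp (w.initial (w.pos a)) a ∪ G.comp (w.initial (w.pos b)) b)
    · exact Or.inl (Set.subset_union_left.trans (subset_comp ht
        (Set.union_subset (comp_subset.trans fun x hx => le_trans hx h) comp_subset)
        (Or.inr (mem_comp (key b)))))
    · exact Or.inr (Or.inr ht)
  MaximalTubing.ofFamily (fun a => G.comp (w.initial (w.pos a)) a)
    (fun a => isTube_comp (key a)) (fun a => mem_comp (key a))
    (fun a b => (le_total (w.pos a) (w.pos b)).elim (nest a b) fun h => (nest b a h).symm)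
    (fun a b hab hba => by
      have h1 : a ∈ w.initial (w.pos b) := comp_subset hab
      have h2 : b ∈ w.initial (w.pos a) := comp_subset hba
      exact w.pos_injective (le_antisymm h1 h2))

end SimpleGraph

/-! ### Biclosed relations and the weak order -/

namespace WeakPerm

variable {n : ℕ}

/-! The weak order and $L_G$ are compared through inversion sets. Inversion sets of permutations are
exactly the biclosed relations. Right-filledness makes the inversion set of every maximal tubing $T$
biclosed, so $T$ has a permutation `toPerm` with the same inversions. This permutation is a linear
extension of the forest of $T$, and `psi` sends every linear extension back to $T$
(`psi_eq_of_linearExtension`, `psi_toPerm`).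

The flip order is containment of inversion sets. A flip loses no inversion (`Flip.inv_subset`).
Conversely, containment gives $\mathrm{toPerm}(T)\le\mathrm{toPerm}(T')$ in the weak order. A chain
of exchanges of ascents leads from one to the other, and `psi` turns each exchange into a flip or an
equality (`psi_le_psi_of_isSwap`).

Finally, `toPerm` is left adjoint to `psi` (`toPerm_le_iff`). Hence `psi` preserves meets, $L_G$
inherits a lattice structure, and $L_G$ is isomorphic to the set of permutations fixed by `toPerm`
after `psi`. These are the $G$-permutations (`isGPermutation_iff`). -/

/-- A relation contained in `<` that is transitive and whose complement in `<` is transitive. -/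
structure Biclosed (R : Fin n → Fin n → Prop) : Prop where
  lt : ∀ {i j}, R i j → i < j
  trans : ∀ {i j k}, R i j → R j k → R i k
  cotrans : ∀ {i j k}, i < j → j < k → R i k → R i j ∨ R j k

theorem biclosed_inv (w : WeakPerm n) : Biclosed fun i j => (i, j) ∈ w.inv where
  lt h := h.1
  trans h h' := ⟨h.1.trans h'.1, h'.2.trans h.2⟩
  cotrans {i j k} hij hjk h := by
    rcases lt_or_ge (w.pos j) (w.pos i) with h' | h'
    · exact Or.inl ⟨hij, h'⟩
    · exact Or.inr ⟨hjk, lt_of_lt_of_le h.2 h'⟩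

namespace Biclosed

variable {R R' : Fin n → Fin n → Prop}

theorem compl (h : Biclosed R) : Biclosed fun i j => i < j ∧ ¬ R i j where
  lt h' := h'.1
  trans := fun h1 h2 => ⟨h1.1.trans h2.1, fun h3 =>
    (h.cotrans h1.1 h2.1 h3).elim h1.2 h2.2⟩
  cotrans := fun h1 h2 h3 => by
    by_contra hcon
    push Not at hcon
    exact h3.2 (h.trans (hcon.1 h1) (hcon.2 h2))

/-- For cotransitivity, follow a chain from $i$ to $k$. The intermediate $j$ is either a vertex of
the chain, which is cut there, or lies strictly inside one step, which splits because it belongs to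
a biclosed relation. -/
theorem transGen_or (h : Biclosed R) (h' : Biclosed R') :
    Biclosed (Relation.TransGen fun i j => R i j ∨ R' i j) where
  lt := fun H => by
    induction H with
    | single H => exact H.elim h.lt h'.lt
    | tail _ H ih => exact ih.trans (H.elim h.lt h'.lt)
  trans := Relation.TransGen.trans
  cotrans := fun {i j k} hij hjk H => by
    have base : ∀ {a c : Fin n}, a < j → j < c → (R a c ∨ R' a c) →
        (R a j ∨ R' a j) ∨ (R j c ∨ R' j c) := by
      intro a c haj hjc H
      rcases H with H | H
      · exact (h.cotrans haj hjc H).imp Or.inl Or.inl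
      · exact (h'.cotrans haj hjc H).imp Or.inr Or.inr
    induction H with
    | single H => exact (base hij hjk H).imp .single .single
    | @tail b c H1 H2 ih =>
      rcases lt_trichotomy j b with hjb | rfl | hbj
      · exact (ih hjb).imp id fun H => H.tail H2
      · exact Or.inl H1
      · exact (base hbj hjk H2).imp H1.tail .single

/-- Every biclosed relation is the inversion set of a permutation. -/
theorem exists_inv (h : Biclosed R) : ∃ w : WeakPerm n, ∀ i j, (i, j) ∈ w.inv ↔ R i j := by
  classical
  -- The order of the one-line notation to be built: `P a b` says that $a$ precedes $b$. It is a
  -- strict total order.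
  let P : Fin n → Fin n → Prop := fun a b => (a < b ∧ ¬ R a b) ∨ R b a
  have P_irrefl : ∀ a, ¬ P a a := by
    rintro a (⟨h1, -⟩ | h1)
    · exact lt_irrefl _ h1
    · exact lt_irrefl _ (h.lt h1)
  have P_trans : ∀ {a b c}, P a b → P b c → P a c := by
    rintro a b c (⟨h1, h2⟩ | h1) (⟨h3, h4⟩ | h3)
    · exact Or.inl (h.compl.trans ⟨h1, h2⟩ ⟨h3, h4⟩)
    · rcases lt_trichotomy a c with hac | rfl | hca
      · exact Or.inl ⟨hac, fun h5 => h2 (h.trans h5 h3)⟩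
      · exact absurd h3 h2
      · exact Or.inr ((h.cotrans hca h1 h3).resolve_right h2)
    · rcases lt_trichotomy a c with hac | rfl | hca
      · exact Or.inl ⟨hac, fun h5 => h4 (h.trans h1 h5)⟩
      · exact absurd h1 h4
      · exact Or.inr ((h.cotrans h3 hca h1).resolve_left h4)
    · exact Or.inr (h.trans h3 h1)
  have P_total : ∀ {a b}, a ≠ b → P a b ∨ P b a := by
    intro a b hab
    rcases lt_or_gt_of_ne hab with hlt | hlt
    · by_cases h1 : R a b
      · exact Or.inr (Or.inr h1)
      · exact Or.inl (Or.inl ⟨hlt, h1⟩)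
    · by_cases h1 : R b a
      · exact Or.inl (Or.inr h1)
      · exact Or.inr (Or.inl ⟨hlt, h1⟩)
  -- The position of $a$, counted from 0, is the number of its predecessors.
  let c : Fin n → ℕ := fun a => (Finset.univ.filter fun b => P b a).card
  have c_lt : ∀ {a b}, P a b → c a < c b := by
    intro a b hab
    refine Finset.card_lt_card ((Finset.ssubset_iff_of_subset ?_).2 ⟨a, ?_, ?_⟩)
    · intro x hx
      simp only [Finset.mem_filter, Finset.mem_univ, true_and] at hx ⊢
      exact P_trans hx hab
    · simpa using hab
    · simpa using P_irrefl a
  have c_bound : ∀ a, c a < n := by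
    intro a
    have : c a < (Finset.univ : Finset (Fin n)).card := by
      refine Finset.card_lt_card ((Finset.ssubset_iff_of_subset (Finset.subset_univ _)).2
        ⟨a, Finset.mem_univ _, ?_⟩)
      simpa using P_irrefl a
    simpa using this
  let p : Fin n → Fin n := fun a => ⟨c a, c_bound a⟩
  have p_lt : ∀ {a b}, P a b → p a < p b := fun hab => c_lt hab
  have p_inj : Function.Injective p := by
    intro a b hab
    by_contra hne
    rcases P_total hne with h1 | h1
    · exact (p_lt h1).ne hab
    · exact (p_lt h1).ne' hab
  refine ⟨(Equiv.ofBijective p (Finite.injective_iff_bijective.1 p_inj)).symm, fun i j => ?_⟩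
  change (i < j ∧ p j < p i) ↔ R i j
  refine ⟨fun ⟨h1, h2⟩ => ?_, fun h1 => ⟨h.lt h1, p_lt (Or.inr h1)⟩⟩
  by_contra h3
  exact lt_asymm h2 (p_lt (Or.inl ⟨h1, h3⟩))

end Biclosed

/-! ### Joins and meets in the weak order. -/

theorem exists_isLUB_pair (w w' : WeakPerm n) : ∃ v, IsLUB {w, w'} v := by
  obtain ⟨v, hv⟩ := (w.biclosed_inv.transGen_or w'.biclosed_inv).exists_inv
  refine ⟨v, ?_, ?_⟩
  · rintro u (rfl | rfl)
    · exact fun ⟨i, j⟩ h => (hv i j).2 (.single (Or.inl h))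
    · exact fun ⟨i, j⟩ h => (hv i j).2 (.single (Or.inr h))
  · rintro u hu ⟨i, j⟩ h
    have h1 : w.inv ⊆ u.inv := hu (Set.mem_insert _ _)
    have h2 : w'.inv ⊆ u.inv := hu (Set.mem_insert_of_mem _ rfl)
    have H := (hv i j).1 h
    induction H with
    | single H => exact H.elim (@h1 _) (@h2 _)
    | @tail b c H1 H2 ih =>
      exact u.biclosed_inv.trans (ih ((hv _ _).2 H1)) (H2.elim (@h1 _) (@h2 _))

/-- Dual to joins: the non-inversions of the meet are the transitive closure of the union of the two
sets of non-inversions. -/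
theorem exists_isGLB_pair (w w' : WeakPerm n) : ∃ v, IsGLB {w, w'} v := by
  obtain ⟨v, hv⟩ :=
    (w.biclosed_inv.compl.transGen_or w'.biclosed_inv.compl).compl.exists_inv
  refine ⟨v, ?_, ?_⟩
  · rintro u (rfl | rfl)
    · rintro ⟨i, j⟩ h
      by_contra hn
      exact ((hv i j).1 h).2 (.single (Or.inl ⟨h.1, hn⟩))
    · rintro ⟨i, j⟩ h
      by_contra hn
      exact ((hv i j).1 h).2 (.single (Or.inr ⟨h.1, hn⟩))
  · rintro u hu ⟨i, j⟩ h
    have h1 : u.inv ⊆ w.inv := hu (Set.mem_insert _ _)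
    have h2 : u.inv ⊆ w'.inv := hu (Set.mem_insert_of_mem _ rfl)
    refine (hv i j).2 ⟨h.1, fun H => ?_⟩
    have key : i < j ∧ (i, j) ∉ u.inv := by
      clear h
      induction H with
      | single H =>
        exact H.elim (fun H => ⟨H.1, fun h => H.2 (h1 h)⟩) (fun H => ⟨H.1, fun h => H.2 (h2 h)⟩)
      | @tail b c H1 H2 ih =>
        exact u.biclosed_inv.compl.trans ih (H2.elim
          (fun H => ⟨H.1, fun h => H.2 (h1 h)⟩) (fun H => ⟨H.1, fun h => H.2 (h2 h)⟩))
    exact key.2 h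

/-- The weak order is a lattice. -/
noncomputable instance : Lattice (WeakPerm n) where
  sup w w' := (exists_isLUB_pair w w').choose
  le_sup_left w w' := (exists_isLUB_pair w w').choose_spec.1 (Set.mem_insert _ _)
  le_sup_right w w' := (exists_isLUB_pair w w').choose_spec.1 (Set.mem_insert_of_mem _ rfl)
  sup_le w w' u h h' := (exists_isLUB_pair w w').choose_spec.2 (by
    rintro x (rfl | rfl)
    exacts [h, h'])
  inf w w' := (exists_isGLB_pair w w').choose
  inf_le_left w w' := (exists_isGLB_pair w w').choose_spec.1 (Set.mem_insert _ _)
  inf_le_right w w' := (exists_isGLB_pair w w').choose_spec.1 (Set.mem_insert_of_mem _ rfl)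
  le_inf u w w' h h' := (exists_isGLB_pair w w').choose_spec.2 (by
    rintro x (rfl | rfl)
    exacts [h, h'])

/-! ### Exchanges of consecutive entries. -/

/-- `w'` arises from `w` by exchanging the consecutive entries `a` and `b`, of which `a` comes
first in `w`. -/
structure IsSwap (w w' : WeakPerm n) (a b : Fin n) : Prop where
  consecutive : (w.pos b).val = (w.pos a).val + 1
  pos_left : w'.pos a = w.pos b
  pos_right : w'.pos b = w.pos a
  pos_of_ne : ∀ x, x ≠ a → x ≠ b → w'.pos x = w.pos x

theorem exists_isSwap {w : WeakPerm n} {a b : Fin n}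
    (h : (w.pos b).val = (w.pos a).val + 1) : ∃ w', IsSwap w w' a b := by
  refine ⟨(Equiv.trans (Equiv.swap (w.pos a) (w.pos b)) w :), h, ?_, ?_, fun x hxa hxb => ?_⟩
  · exact Equiv.swap_apply_left _ _
  · exact Equiv.swap_apply_right _ _
  · exact Equiv.swap_apply_of_ne_of_ne (fun h => hxa (w.pos_injective h))
      (fun h => hxb (w.pos_injective h))

/-- Since $a$ and $b$ are consecutive, any other entry lies on the same side of both, so only the
relative order of $a$ and $b$ changes. -/
theorem IsSwap.inv_eq {w w' : WeakPerm n} {a b : Fin n} (h : IsSwap w w' a b) (hab : a < b) :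
    w'.inv = insert (a, b) w.inv := by
  have inj : ∀ {x y}, (w.pos x).val = (w.pos y).val → x = y := fun e =>
    w.pos_injective (Fin.ext e)
  have hc := h.consecutive
  ext ⟨i, j⟩
  simp only [inv, Set.mem_ofPred_eq, Set.mem_insert_iff, Prod.mk.injEq, Fin.lt_def] at hab ⊢
  have h1 := h.pos_left
  have h2 := h.pos_right
  by_cases hia : i = a
  · subst hia
    by_cases hjb : j = b
    · subst hjb
      rw [h1, h2]
      simp only [and_self, true_or, iff_true]
      omega
    · by_cases hji : j = i
      · subst hji
        simp [hjb]
      · have e1 : (w.pos j).val ≠ (w.pos b).val := fun e => hjb (inj e)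
        have e2 : (w.pos j).val ≠ (w.pos i).val := fun e => hji (inj e)
        rw [h1, h.pos_of_ne j hji hjb]
        simp only [hjb, and_false, false_or]
        omega
  · simp only [hia, false_and, false_or]
    have e1 : (w.pos i).val ≠ (w.pos a).val := fun e => hia (inj e)
    by_cases hib : i = b
    · subst hib
      by_cases hja : j = a
      · subst hja
        omega
      · by_cases hji : j = i
        · subst hji
          simp
        · have e3 : (w.pos j).val ≠ (w.pos a).val := fun e => hja (inj e)
          rw [h2, h.pos_of_ne j hja hji]
          omega
    · have e2 : (w.pos i).val ≠ (w.pos b).val := fun e => hib (inj e)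
      rw [h.pos_of_ne i hia hib]
      by_cases hja : j = a
      · subst hja
        rw [h1]
        omega
      · by_cases hjb : j = b
        · subst hjb
          rw [h2]
          omega
        · rw [h.pos_of_ne j hja hjb]

/-- Below a larger element of the weak order there is an ascent that may be exchanged. -/
theorem exists_ascent {w v : WeakPerm n} (hle : w ≤ v) (hne : w ≠ v) :
    ∃ a b, a < b ∧ (w.pos b).val = (w.pos a).val + 1 ∧ (a, b) ∈ v.inv := by
  by_contra hcon
  push Not at hcon
  -- Without an exchangeable ascent, neighbours in $w$ keep their order in $v$: ascents by
  -- assumption, descents because they are inversions of $w$ and hence of $v$. Then $v$ orders all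
  -- entries as $w$ does.
  have step : ∀ i j : Fin n, j.val = i.val + 1 → v.pos (w.entry i) < v.pos (w.entry j) := by
    intro i j hij
    have hij' : i < j := Fin.lt_def.2 (by omega)
    have hne : w.entry i ≠ w.entry j := fun e => by
      have := congrArg w.pos e
      rw [w.pos_entry, w.pos_entry] at this
      exact hij'.ne this
    rcases lt_or_gt_of_ne hne with h | h
    · have := hcon _ _ h (by rw [w.pos_entry, w.pos_entry, hij])
      refine lt_of_le_of_ne (not_lt.1 fun h' => this ⟨h, h'⟩) fun e => ?_
      exact hne (v.pos_injective e)
    · exact (hle (show (w.entry j, w.entry i) ∈ w.inv from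
        ⟨h, by simpa only [w.pos_entry] using hij'⟩)).2
  have mono : ∀ d (i j : Fin n), j.val = i.val + d + 1 →
      v.pos (w.entry i) < v.pos (w.entry j) := by
    intro d
    induction d with
    | zero => exact fun i j hij => step i j hij
    | succ d ih =>
      intro i j hij
      have hj := j.isLt
      exact (ih i ⟨i.val + d + 1, by omega⟩ rfl).trans (step _ j hij)
  have mono' : ∀ {x y}, w.pos x < w.pos y → v.pos x < v.pos y := by
    intro x y hxy
    have := mono ((w.pos y).val - (w.pos x).val - 1) (w.pos x) (w.pos y)
      (by rw [Fin.lt_def] at hxy; omega)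
    rwa [w.entry_pos, w.entry_pos] at this
  refine hne (le_antisymm hle ?_)
  rintro ⟨i, j⟩ h
  refine ⟨h.1, ?_⟩
  by_contra hn
  have h2 : w.pos i < w.pos j :=
    lt_of_le_of_ne (not_lt.1 hn) fun e => h.1.ne (w.pos_injective e)
  exact lt_asymm h.2 (mono' h2)

/-- Induction along the weak order: a relation that is transitive and holds for every exchange of
an ascent holds for comparable elements. -/
theorem le_induction {P : WeakPerm n → WeakPerm n → Prop} (refl : ∀ w, P w w)
    (trans : ∀ u v w, P u v → P v w → P u w)
    (swap : ∀ u v a b, a < b → IsSwap u v a b → P u v) {w v : WeakPerm n} (h : w ≤ v) :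
    P w v := by
  -- Induction on the number of inversions of $v$ missing from $w$; each exchange supplies one of
  -- them.
  induction hm : (v.inv \ w.inv).ncard using Nat.strong_induction_on generalizing w with
  | _ m ih =>
    by_cases hne : w = v
    · exact hne ▸ refl w
    obtain ⟨a, b, hab, hc, hv⟩ := exists_ascent h hne
    obtain ⟨u, hu⟩ := exists_isSwap hc
    have hinv := hu.inv_eq hab
    have huv : u ≤ v := by
      change u.inv ⊆ v.inv
      rw [hinv]
      exact Set.insert_subset hv h
    have hw : (a, b) ∉ w.inv := fun h' => by
      have := Fin.lt_def.1 h'.2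
      simp only at this
      omega
    refine trans _ _ _ (swap _ _ _ _ hab hu) (ih _ ?_ huv rfl)
    rw [← hm, hinv]
    refine Set.ncard_lt_ncard ((Set.ssubset_iff_of_subset ?_).2 ⟨(a, b), ⟨hv, hw⟩, ?_⟩)
      (Set.toFinite _)
    · exact Set.sdiff_subset_sdiff_right (Set.subset_insert _ _)
    · exact fun h' => h'.2 (Set.mem_insert _ _)

end WeakPerm

/-! ### Tubes of right-filled graphs -/

namespace SimpleGraph

variable {n : ℕ} {G : SimpleGraph (Fin n)} {I S S' : Set (Fin n)} {a b i j k : Fin n}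

theorem comp_mono (h : S ⊆ S') : G.comp S a ⊆ G.comp S' a :=
  Set.sUnion_subset_sUnion fun _ hI => ⟨hI.1, hI.2.1.trans h, hI.2.2⟩

theorem comp_eq_of_mem (ha : a ∈ S) (hb : b ∈ G.comp S a) : G.comp S b = G.comp S a := by
  have h1 : G.comp S a ⊆ G.comp S b := subset_comp (isTube_comp ha) comp_subset hb
  exact (subset_comp (isTube_comp (comp_subset hb)) comp_subset (h1 (mem_comp ha))).antisymm h1

theorem comp_eq_of_subset (ha : a ∈ S') (h : S ⊆ S') (h' : G.comp S' a ⊆ S) :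
    G.comp S a = G.comp S' a :=
  (comp_mono h).antisymm (subset_comp (isTube_comp ha) h' (mem_comp ha))

theorem mem_comp_of_adj (hi : i ∈ G.comp S a) (ha : a ∈ S) (hj : j ∈ S) (h : G.Adj i j) :
    j ∈ G.comp S a :=
  subset_comp ((isTube_comp ha).union_adj (isTube_singleton j) hi rfl h)
    (Set.union_subset comp_subset (by simpa using hj)) (Or.inl (mem_comp ha)) (Or.inr rfl)

namespace RightFilled

/-- Two vertices of a tube can be joined within the tube by vertices not below the smaller. -/
theorem exists_tube_ge (hG : G.RightFilled) (hI : G.IsTube I) (hi : i ∈ I) (hj : j ∈ I)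
    (hij : i ≤ j) : ∃ C, G.IsTube C ∧ C ⊆ I ∧ (∀ x ∈ C, i ≤ x) ∧ i ∈ C ∧ j ∈ C := by
  have hiS : i ∈ I ∩ Set.Ici i := ⟨hi, le_refl i⟩
  refine ⟨G.comp (I ∩ Set.Ici i) i, isTube_comp hiS, comp_subset.trans Set.inter_subset_left,
    fun x hx => (comp_subset hx).2, mem_comp hiS, ?_⟩
  by_contra hjC
  -- If $j$ is not reached, some edge $uv$ of $I$ leaves the union of the component of $i$ and the
  -- vertices below $i$. If $u<i$, right-filledness replaces it by the edge $iv$, so $v$ lies in the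
  -- component anyway.
  obtain ⟨u, -, huS, v, hv, hvS, huv⟩ := hI.exists_adj
    (S := {x | x < i ∨ x ∈ G.comp (I ∩ Set.Ici i) i}) hi (Or.inr (mem_comp hiS))
    fun h => (h hj).elim (not_lt.2 hij) hjC
  have hvi : i ≤ v := not_lt.1 fun h => hvS (Or.inl h)
  have hne : i ≠ v := by
    rintro rfl
    exact hvS (Or.inr (mem_comp hiS))
  refine hvS (Or.inr ?_)
  rcases huS with hu | hu
  · exact mem_comp_of_adj (mem_comp hiS) hiS ⟨hv, hvi⟩
      (hG u i v hu (lt_of_le_of_ne hvi hne) huv)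
  · exact mem_comp_of_adj hu hiS ⟨hv, hvi⟩ huv

/-- A vertex that lies between two vertices of a tube belongs or is adjacent to the tube. -/
theorem exists_adj_of_between (hG : G.RightFilled) (hI : G.IsTube I) (hi : i ∈ I) (hk : k ∈ I)
    (hij : i < j) (hjk : j < k) (hj : j ∉ I) : ∃ v ∈ I, G.Adj j v := by
  obtain ⟨u, -, hu, v, hv, hvj, huv⟩ := hI.exists_adj (S := Set.Iio j) hi hij
    fun h => lt_asymm hjk (h hk)
  refine ⟨v, hv, hG u j v hu (lt_of_le_of_ne (not_lt.1 hvj) ?_) huv⟩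
  rintro rfl
  exact hj hv

end RightFilled

/-! ### Inversion sets of maximal tubings -/

namespace MaximalTubing

variable {X Y : G.MaximalTubing} {w w' : WeakPerm n}

theorem down_injective (X : G.MaximalTubing) : Function.Injective X.down := fun i j h =>
  X.down_antisymm i j (h ▸ X.mem_down i) (h ▸ X.mem_down j)

theorem isTube_down (X : G.MaximalTubing) (i : Fin n) : G.IsTube (X.down i) :=
  X.isTubing.1 _ (X.down_mem i)

theorem ext_down (h : ∀ i, X.down i = Y.down i) : X = Y := by
  refine equivGForest.injective (GForest.ext ?_)
  funext j i
  exact congrArg (j ∈ ·) (h i)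

theorem down_of_isTop (hI : I ∈ X.tubes) (h : X.IsTop I a) : X.down a = I := by
  by_contra hne
  exact h.2 _ (X.down_mem a) (Set.ssubset_iff_subset_ne.2 ⟨X.down_subset hI h.1, hne⟩)
    (X.mem_down a)

theorem isTop_down (X : G.MaximalTubing) (a : Fin n) : X.IsTop (X.down a) a :=
  ⟨X.mem_down a, fun _ hJ hlt ha => hlt.2 (X.down_subset hJ ha)⟩

theorem subset_or_subset_of_adj (hI : I ∈ X.tubes) (hJ : S ∈ X.tubes) (hi : i ∈ I) (hj : j ∈ S)
    (h : G.Adj i j) : I ⊆ S ∨ S ⊆ I := by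
  rcases X.isTubing.2 _ hI _ hJ with h' | h' | h'
  · exact Or.inl h'
  · exact Or.inr h'
  · exact absurd ((X.isTubing.1 _ hI).union_adj (X.isTubing.1 _ hJ) hi hj h) h'

/-- Cotransitivity is where right-filledness enters: an intermediate $j\notin i_\downarrow$ is
adjacent to $i_\downarrow$, so $i_\downarrow$ and $j_\downarrow$ are nested, and only
$i_\downarrow\subseteq j_\downarrow$ is possible. -/
theorem biclosed_inv (hG : G.RightFilled) (X : G.MaximalTubing) :
    WeakPerm.Biclosed fun i j => (i, j) ∈ X.forest.inv where
  lt h := h.1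
  trans h h' := ⟨h.1.trans h'.1, X.forest.trans _ _ _ h'.2 h.2⟩
  cotrans {i j k} hij hjk h := by
    by_cases hj : j ∈ X.down i
    · exact Or.inl ⟨hij, hj⟩
    obtain ⟨v, hv, hadj⟩ :=
      hG.exists_adj_of_between (X.isTube_down i) (X.mem_down i) h.2 hij hjk hj
    rcases subset_or_subset_of_adj (X.down_mem j) (X.down_mem i) (X.mem_down j) hv hadj
      with h' | h'
    · exact absurd (h' (X.mem_down j)) hj
    · exact Or.inr ⟨hjk, h' h.2⟩

/-- The permutation with the same inversion set as a maximal tubing. -/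
noncomputable def toPerm (hG : G.RightFilled) (X : G.MaximalTubing) : WeakPerm n :=
  (X.biclosed_inv hG).exists_inv.choose

theorem inv_toPerm (hG : G.RightFilled) (X : G.MaximalTubing) :
    (X.toPerm hG).inv = X.forest.inv :=
  Set.ext fun ⟨i, j⟩ => (X.biclosed_inv hG).exists_inv.choose_spec i j

theorem down_psi (w : WeakPerm n) (a : Fin n) :
    (G.psi w).down a = G.comp (w.initial (w.pos a)) a := by
  have ha : a ∈ w.initial (w.pos a) := le_refl (w.pos a)
  refine ((G.psi w).down_subset ⟨a, rfl⟩ (mem_comp ha)).antisymm ?_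
  obtain ⟨b, hb⟩ := (G.psi w).down_mem a
  have hab : a ∈ G.comp (w.initial (w.pos b)) b := by
    have := (G.psi w).mem_down a
    rw [← hb] at this
    exact this
  rw [← hb]
  have hb' : b ∈ w.initial (w.pos b) := le_refl (w.pos b)
  change _ ⊆ G.comp (w.initial (w.pos b)) b
  rw [← comp_eq_of_mem hb' hab]
  have hle : w.pos a ≤ w.pos b := comp_subset hab
  exact comp_mono fun x hx => le_trans hx hle

/-- The tube $i_\downarrow$ lies in the initial segment ending at $i$. If its component there were
larger, an edge would lead from $i_\downarrow$ to some $v$ outside it, forcing $i_\downarrow\subset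
v_\downarrow$; but then $i$ would precede $v$. -/
theorem psi_eq_of_linearExtension (h : ∀ i, ∀ j ∈ X.down i, w.pos j ≤ w.pos i) :
    G.psi w = X := by
  refine ext_down fun i => ?_
  rw [down_psi]
  have hi : i ∈ w.initial (w.pos i) := le_refl (w.pos i)
  refine Set.Subset.antisymm ?_ (subset_comp (X.isTube_down i) (h i) (X.mem_down i))
  by_contra hns
  obtain ⟨u, -, hu, v, hv, hvX, huv⟩ :=
    (isTube_comp (G := G) hi).exists_adj (mem_comp hi) (X.mem_down i) hns
  rcases subset_or_subset_of_adj (X.down_mem i) (X.down_mem v) hu (X.mem_down v) huv with h' | h'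
  · have h1 : w.pos v ≤ w.pos i := comp_subset hv
    have h2 := h v i (h' (X.mem_down i))
    rw [w.pos_injective (le_antisymm h1 h2)] at hvX
    exact hvX (X.mem_down i)
  · exact hvX (h' (X.mem_down v))

theorem inv_psi_subset (w : WeakPerm n) : (G.psi w).forest.inv ⊆ w.inv := by
  rintro ⟨i, j⟩ ⟨hij, h⟩
  change j ∈ (G.psi w).down i at h
  rw [down_psi] at h
  exact ⟨hij, lt_of_le_of_ne (comp_subset h) fun e => hij.ne' (w.pos_injective e)⟩

/-- Join $i$ to $j$ within $i_\downarrow$ through vertices not below $i$. Each one other than $i$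
forms an inversion with $i$, so it precedes $i$ in $w$, and the whole connection lies in the initial
segment ending at $i$. -/
theorem inv_subset_inv_psi (hG : G.RightFilled) (h : X.forest.inv ⊆ w.inv) :
    X.forest.inv ⊆ (G.psi w).forest.inv := by
  rintro ⟨i, j⟩ ⟨hij, hj⟩
  refine ⟨hij, ?_⟩
  change j ∈ (G.psi w).down i
  rw [down_psi]
  obtain ⟨C, hC, hCX, hge, hiC, hjC⟩ :=
    hG.exists_tube_ge (X.isTube_down i) (X.mem_down i) hj (le_of_lt hij)
  refine subset_comp hC (fun x hx => ?_) hiC hjC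
  rcases (hge x hx).eq_or_lt with rfl | hlt
  · exact le_refl (w.pos i)
  · exact le_of_lt (h (show (i, x) ∈ X.forest.inv from ⟨hlt, hCX hx⟩)).2

theorem psi_toPerm (hG : G.RightFilled) (X : G.MaximalTubing) : G.psi (X.toPerm hG) = X := by
  refine psi_eq_of_linearExtension fun i j hj => ?_
  rcases lt_trichotomy i j with h | rfl | h
  · have : (i, j) ∈ (X.toPerm hG).inv := by
      rw [inv_toPerm]
      exact ⟨h, hj⟩
    exact le_of_lt this.2
  · exact le_rfl
  · by_contra hn
    have : (j, i) ∈ (X.toPerm hG).inv := ⟨h, not_le.1 hn⟩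
    rw [inv_toPerm] at this
    exact h.ne (X.down_antisymm j i hj this.2)

theorem inv_injective (hG : G.RightFilled) (h : X.forest.inv = Y.forest.inv) : X = Y := by
  rw [← X.psi_toPerm hG, ← Y.psi_toPerm hG]
  congr 1
  exact WeakPerm.inv_injective (by rw [inv_toPerm, inv_toPerm, h])

/-! ### Flips -/

theorem Flip.inv_subset (hG : G.RightFilled) (h : Flip X Y) : X.forest.inv ⊆ Y.forest.inv := by
  obtain ⟨I, hI, J, hJ, -, hY, a, b, ha, hb, hab⟩ := h
  have hXY : ∀ K ∈ X.tubes, K ≠ I → K ∈ Y.tubes := fun K hK hne => by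
    rw [hY]
    exact Or.inl ⟨hK, hne⟩
  have hYX : ∀ K ∈ Y.tubes, K ≠ J → K ∈ X.tubes := fun K hK hne => by
    rw [hY] at hK
    exact (hK.resolve_right hne).1
  have hXa := down_of_isTop hI ha
  have hYb := down_of_isTop hJ hb
  rintro ⟨i, j⟩ ⟨hij, hj⟩
  change j ∈ X.down i at hj
  refine ⟨hij, ?_⟩
  change j ∈ Y.down i
  -- Every tube of $Y$ except $J$ is a tube of $X$, so only the smallest tube around $b$, the top of
  -- $J$, could lose elements.
  by_cases hi : Y.down i = J
  · obtain rfl : i = b := Y.down_injective (hi.trans hYb.symm)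
    rw [hYb]
    obtain ⟨C, hC, hCX, hge, hiC, hjC⟩ :=
      hG.exists_tube_ge (X.isTube_down i) (X.mem_down i) hj (le_of_lt hij)
    by_contra hjJ
    obtain ⟨u, -, huJ, v, hv, hvJ, huv⟩ :=
      hC.exists_adj hiC hb.1 fun h => hjJ (h hjC)
    -- The connection from $b$ to $j$ stays at or above $b>a$, so it avoids the top $a$ of $I$.
    -- Hence $v_\downarrow$ survives the flip and must be nested with the adjacent tube $J$.
    have hva : X.down v ≠ I := fun e => by
      obtain rfl := X.down_injective (e.trans hXa.symm)
      exact absurd (hge v hv) (not_le.2 hab)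
    rcases subset_or_subset_of_adj hJ (hXY _ (X.down_mem v) hva) huJ (X.mem_down v) huv
      with h' | h'
    · obtain rfl := X.down_antisymm v i (hCX hv) (h' hb.1)
      exact hvJ hb.1
    · exact hvJ (h' (X.mem_down v))
  · exact X.down_subset (hYX _ (Y.down_mem i) hi) (Y.mem_down i) hj

theorem tubes_eq_range (X : G.MaximalTubing) : X.tubes = Set.range X.down := by
  refine (X.forest.tubing.maximal _ X.isTubing ?_)
  rintro _ ⟨i, rfl⟩
  exact X.down_mem i

/-- The exchange of an ascent of a permutation is mapped by `psi` to a flip or to an equality. -/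
theorem psi_le_psi_of_isSwap (hab : a < b) (h : WeakPerm.IsSwap w w' a b) :
    G.psi w ≤ G.psi w' := by
  have hc := h.consecutive
  have inj : ∀ {x y}, (w.pos x).val = (w.pos y).val → x = y := fun e =>
    w.pos_injective (Fin.ext e)
  have hne := hab.ne
  have init_a : w'.initial (w'.pos a) = w.initial (w.pos b) := by
    ext x
    simp only [WeakPerm.initial, Set.mem_ofPred_eq, Fin.le_def]
    rw [h.pos_left]
    by_cases hxa : x = a
    · subst hxa
      rw [h.pos_left]
      omega
    by_cases hxb : x = b
    · subst hxb
      rw [h.pos_right]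
      omega
    rw [h.pos_of_ne x hxa hxb]
  have init_b : w'.initial (w'.pos b) = w.initial (w.pos b) \ {a} := by
    ext x
    simp only [WeakPerm.initial, Set.mem_sdiff, Set.mem_singleton_iff, Set.mem_ofPred_eq,
      Fin.le_def]
    rw [h.pos_right]
    by_cases hxa : x = a
    · subst hxa
      rw [h.pos_left]
      simp only [not_true, and_false, iff_false]
      omega
    by_cases hxb : x = b
    · subst hxb
      rw [h.pos_right]
      simp [hxa]
    have : (w.pos x).val ≠ (w.pos b).val := fun e => hxb (inj e)
    rw [h.pos_of_ne x hxa hxb]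
    simp only [hxa, not_false_eq_true, and_true]
    omega
  have init_a' : w.initial (w.pos a) = w.initial (w.pos b) \ {b} := by
    ext x
    simp only [WeakPerm.initial, Set.mem_sdiff, Set.mem_singleton_iff, Set.mem_ofPred_eq,
      Fin.le_def]
    by_cases hxb : x = b
    · subst hxb
      simp only [not_true, and_false, iff_false]
      omega
    have : (w.pos x).val ≠ (w.pos b).val := fun e => hxb (inj e)
    simp only [hxb, not_false_eq_true, and_true]
    omega
  have down_eq : ∀ c, c ≠ a → c ≠ b → (G.psi w').down c = (G.psi w).down c := by
    intro c hca hcb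
    rw [down_psi, down_psi]
    congr 1
    have e1 : (w.pos c).val ≠ (w.pos a).val := fun e => hca (inj e)
    have e2 : (w.pos c).val ≠ (w.pos b).val := fun e => hcb (inj e)
    ext x
    simp only [WeakPerm.initial, Set.mem_ofPred_eq, Fin.le_def]
    rw [h.pos_of_ne c hca hcb]
    by_cases hxa : x = a
    · subst hxa
      rw [h.pos_left]
      omega
    by_cases hxb : x = b
    · subst hxb
      rw [h.pos_right]
      omega
    rw [h.pos_of_ne x hxa hxb]
  have hbS : b ∈ w.initial (w.pos b) := le_refl (w.pos b)
  have haS : a ∈ w.initial (w.pos b) := Fin.le_def.2 (by omega)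
  -- If $a$ and $b$ share a component once both are present, that tube changes its top from $b$ to
  -- $a$, and the tube with top $a$ is flipped to one with top $b$. Otherwise the exchange affects
  -- neither component.
  by_cases hm : a ∈ (G.psi w).down b
  · have hda : (G.psi w').down a = (G.psi w).down b := by
      rw [down_psi] at hm
      rw [down_psi, down_psi, init_a, comp_eq_of_mem hbS hm]
    refine .single ⟨_, (G.psi w).down_mem a, _, (G.psi w').down_mem b, ?_, ?_, a, b,
      isTop_down _ _, isTop_down _ _, hab⟩
    · intro e
      have := (G.psi w).mem_down a
      rw [e, down_psi, init_b] at this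
      exact (comp_subset this).2 rfl
    · rw [tubes_eq_range, tubes_eq_range]
      ext K
      constructor
      · rintro ⟨c, rfl⟩
        by_cases hcb : c = b
        · exact Or.inr (hcb ▸ rfl)
        refine Or.inl ?_
        by_cases hca : c = a
        · subst hca
          rw [hda]
          exact ⟨⟨b, rfl⟩, fun e => hne ((G.psi w).down_injective e).symm⟩
        · rw [down_eq c hca hcb]
          exact ⟨⟨c, rfl⟩, fun e => hca ((G.psi w).down_injective e)⟩
      · rintro (⟨⟨c, rfl⟩, hK⟩ | rfl)
        · by_cases hca : c = a
          · exact absurd (hca ▸ rfl) hK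
          by_cases hcb : c = b
          · exact ⟨a, hcb ▸ hda⟩
          · exact ⟨c, down_eq c hca hcb⟩
        · exact ⟨b, rfl⟩
  · refine le_of_eq (ext_down fun c => ?_)
    rw [down_psi] at hm
    by_cases hca : c = a
    · subst hca
      rw [down_psi, down_psi, init_a, init_a']
      refine comp_eq_of_subset haS Set.sdiff_subset fun x hx => ⟨comp_subset hx, ?_⟩
      rintro rfl
      rw [comp_eq_of_mem haS hx] at hm
      exact hm (mem_comp haS)
    by_cases hcb : c = b
    · subst hcb
      rw [down_psi, down_psi, init_b]
      refine (comp_eq_of_subset hbS Set.sdiff_subset fun x hx => ⟨comp_subset hx, ?_⟩).symm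
      rintro rfl
      exact hm hx
    exact (down_eq c hca hcb).symm

theorem psi_mono (h : w ≤ w') : G.psi w ≤ G.psi w' :=
  WeakPerm.le_induction (P := fun w w' => G.psi w ≤ G.psi w') (fun _ => le_rfl)
    (fun _ _ _ => le_trans) (fun _ _ _ _ => psi_le_psi_of_isSwap) h

/-! ### The flip order, the adjunction and the lattice. -/

theorem le_iff_inv_subset (hG : G.RightFilled) : X ≤ Y ↔ X.forest.inv ⊆ Y.forest.inv := by
  refine ⟨fun h => ?_, fun h => ?_⟩
  · induction h with
    | refl => exact subset_rfl
    | tail _ h ih => exact ih.trans (h.inv_subset hG)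
  · rw [← X.psi_toPerm hG, ← Y.psi_toPerm hG]
    refine psi_mono ?_
    change (X.toPerm hG).inv ⊆ (Y.toPerm hG).inv
    rwa [inv_toPerm, inv_toPerm]

theorem toPerm_le_toPerm_iff (hG : G.RightFilled) : X.toPerm hG ≤ Y.toPerm hG ↔ X ≤ Y := by
  rw [le_iff_inv_subset hG, ← inv_toPerm hG, ← inv_toPerm hG]
  rfl

/-- The adjunction: `psi` loses inversions, but none that form the inversion set of a tubing. -/
theorem toPerm_le_iff (hG : G.RightFilled) : X.toPerm hG ≤ w ↔ X ≤ G.psi w := by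
  rw [le_iff_inv_subset hG]
  change (X.toPerm hG).inv ⊆ w.inv ↔ _
  rw [inv_toPerm]
  exact ⟨inv_subset_inv_psi hG, fun h => h.trans (inv_psi_subset w)⟩

/-- The poset of maximal tubings. -/
abbrev partialOrder (hG : G.RightFilled) : PartialOrder G.MaximalTubing where
  le_antisymm _ _ h h' :=
    inv_injective hG (((le_iff_inv_subset hG).1 h).antisymm ((le_iff_inv_subset hG).1 h'))

/-- The lattice of maximal tubings, in which joins and meets are the images of those of the
associated permutations. -/
noncomputable abbrev lattice (hG : G.RightFilled) : Lattice G.MaximalTubing where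
  toPartialOrder := partialOrder hG
  sup X Y := G.psi (X.toPerm hG ⊔ Y.toPerm hG)
  le_sup_left _ _ := (toPerm_le_iff hG).1 le_sup_left
  le_sup_right _ _ := (toPerm_le_iff hG).1 le_sup_right
  sup_le X Y Z h h' := by
    rw [← Z.psi_toPerm hG]
    exact psi_mono (sup_le ((toPerm_le_toPerm_iff hG).2 h) ((toPerm_le_toPerm_iff hG).2 h'))
  inf X Y := G.psi (X.toPerm hG ⊓ Y.toPerm hG)
  inf_le_left X Y := (psi_mono inf_le_left).trans_eq (X.psi_toPerm hG)
  inf_le_right X Y := (psi_mono inf_le_right).trans_eq (Y.psi_toPerm hG)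
  le_inf _ _ _ h h' := (toPerm_le_iff hG).1
    (le_inf ((toPerm_le_toPerm_iff hG).2 h) ((toPerm_le_toPerm_iff hG).2 h'))

/-- `psi` preserves meets, since it is an upper adjoint. -/
theorem psi_inf (hG : G.RightFilled) (w w' : WeakPerm n) :
    G.psi (w ⊓ w') = (lattice hG).inf (G.psi w) (G.psi w') := by
  let := lattice hG
  refine le_antisymm (le_inf (psi_mono inf_le_left) (psi_mono inf_le_right)) ?_
  exact (toPerm_le_iff hG).1 (le_inf ((toPerm_le_iff hG).2 inf_le_left)
    ((toPerm_le_iff hG).2 inf_le_right))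

/-! ### `G`-permutations -/

/-- As `psi` never adds inversions, the right side means that $w$ and its image have the same ones.
If $k>i$ precedes $i$, then $k$ lies between $i$ and the maximum $m$ of the initial segment or
equals $m$; the component containing $i$ and $m$ then contains or is adjacent to $k$, hence contains
it. Conversely, a maximum $m\ne w_j$ forms an inversion with $w_j$. -/
theorem isGPermutation_iff (hG : G.RightFilled) :
    w.IsGPermutation G ↔ w.inv ⊆ (G.psi w).forest.inv := by
  refine ⟨?_, fun h p m hm => ?_⟩
  · rintro h ⟨i, k⟩ ⟨hik, hk⟩
    refine ⟨hik, ?_⟩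
    change k ∈ (G.psi w).down i
    rw [down_psi]
    have hi : i ∈ w.initial (w.pos i) := le_refl (w.pos i)
    have hkS : k ∈ w.initial (w.pos i) := le_of_lt hk
    obtain ⟨m, hm⟩ : ∃ m, IsGreatest (w.initial (w.pos i)) m := by
      obtain ⟨m, hm, hmax⟩ := Set.exists_max_image (w.initial (w.pos i)) id (Set.toFinite _) ⟨i, hi⟩
      exact ⟨m, hm, fun x hx => hmax x hx⟩
    have hmC := h _ m hm
    rw [w.entry_pos] at hmC
    by_contra hkC
    have hkm : k < m := lt_of_le_of_ne (hm.2 hkS) (by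
      rintro rfl
      exact hkC hmC)
    obtain ⟨v, hv, hadj⟩ :=
      hG.exists_adj_of_between (isTube_comp hi) (mem_comp hi) hmC hik hkm hkC
    exact hkC (mem_comp_of_adj hv hi hkS hadj.symm)
  · have hp : w.entry p ∈ w.initial p := le_of_eq (w.pos_entry p)
    rcases (hm.2 hp).eq_or_lt with e | hlt
    · rw [← e]
      exact mem_comp hp
    · have hmp : w.pos m ≤ p := hm.1
      have hne : w.pos m ≠ p := fun e => hlt.ne (by rw [← e, w.entry_pos])
      have := (h (show (w.entry p, m) ∈ w.inv from
        ⟨hlt, by simpa only [w.pos_entry] using lt_of_le_of_ne hmp hne⟩)).2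
      change m ∈ (G.psi w).down (w.entry p) at this
      rwa [down_psi, w.pos_entry] at this

theorem isGPermutation_toPerm (hG : G.RightFilled) (X : G.MaximalTubing) :
    (X.toPerm hG).IsGPermutation G := by
  rw [isGPermutation_iff hG, psi_toPerm, inv_toPerm]

theorem toPerm_psi (hG : G.RightFilled) (h : w.IsGPermutation G) :
    (G.psi w).toPerm hG = w := by
  refine WeakPerm.inv_injective ?_
  rw [inv_toPerm]
  exact (inv_psi_subset w).antisymm ((isGPermutation_iff hG).1 h)

/-- The poset of maximal tubings is isomorphic to the weak order on `G`-permutations. -/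
noncomputable def orderIsoGPermutation (hG : G.RightFilled) :
    G.MaximalTubing ≃o {w : WeakPerm n // w.IsGPermutation G} where
  toFun X := ⟨X.toPerm hG, X.isGPermutation_toPerm hG⟩
  invFun w := G.psi w.1
  left_inv X := X.psi_toPerm hG
  right_inv w := Subtype.ext (toPerm_psi hG w.2)
  map_rel_iff' := toPerm_le_toPerm_iff hG

end MaximalTubing

end SimpleGraph

theorem mainTheorem4 (n : ℕ) (G : SimpleGraph (Fin n)) (hG : G.RightFilled) :
    (∀ T T' : G.MaximalTubing, T ≤ T' ↔ T.forest.inv ⊆ T'.forest.inv) ∧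
    Nonempty (G.MaximalTubing ≃o {w : WeakPerm n // w.IsGPermutation G}) ∧
    ∃ (S : Lattice (WeakPerm n)) (L : Lattice G.MaximalTubing),
      (∀ w w' : WeakPerm n, S.le w w' ↔ w.inv ⊆ w'.inv) ∧
      (∀ T T' : G.MaximalTubing,
        L.le T T' ↔ Relation.ReflTransGen SimpleGraph.MaximalTubing.Flip T T') ∧
      ∀ w w' : WeakPerm n, G.psi (S.inf w w') = L.inf (G.psi w) (G.psi w') :=
  ⟨fun _ _ => SimpleGraph.MaximalTubing.le_iff_inv_subset hG,
    ⟨SimpleGraph.MaximalTubing.orderIsoGPermutation hG⟩,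
    inferInstance, SimpleGraph.MaximalTubing.lattice hG, fun _ _ => Iff.rfl, fun _ _ => Iff.rfl,
    SimpleGraph.MaximalTubing.psi_inf hG⟩
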